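/- Let $r,p,q$ be integers with $r\neq 0$ such that the roots of the quadratic equation $rx^2+px=q$ are real and irrational, and let $\Delta=p^2+4rq$. Let $x$ be a root of this equation, with continued fraction $x=[a_0;a_1,a_2,\dots]$ ($a_0\in\mathbb Z$, $a_i\in\mathbb N$ for $i\ge 1$). This continued fraction is eventually periodic. Let $T$ be its (least) period length, and let $m\ge 0$ be such that $a_{n+T}=a_n$ for all $n>m$, so that $$x=[a_0;\dots,a_m,a_{m+1},\dots,a_{m+T},a_{m+1},\dots,a_{m+T},\dots].$$ Let $\tau(n)$ denote the number of positive divisors of a positive integer $n$. For positive $Q$ of the form $Q=\Delta/4$ put $$f(Q)=2\sum_{u=1}^{\lfloor\sqrt Q\rfloor}\tau(Q-u^2)+\tau(Q)\quad\text{if } Q \text{ is an integer},$$ $$f(Q)=2\sum_{\substack{i\in\{1,3,5,\dots\}\\ i^2<4Q}}\tau\!\left(Q-\frac{i^2}{4}\right)\quad\text{otherwise}.$$ Then $$\sum_{i=1}^{T}a_{m+i}\le f(\Delta/4).$$ If, moreover, $T$ is odd, then $$\sum_{i=1}^{T}a_{m+i}\le \tfrac12 f(\Delta/4).$$ -/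

import Mathlib

/-- The partial quotients `a₀, a₁, a₂, …` of the continued fraction `x = [a₀; a₁, a₂, …]` of a real
number, read off from Mathlib's continued fraction algorithm (the stream of integer and fractional
parts from which `GenContFract.of x` is built). The value `0` is used only past the end of a
terminating expansion, so never for irrational `x`. -/
noncomputable def partialQuotient (x : ℝ) (n : ℕ) : ℤ :=
  match GenContFract.IntFractPair.stream x n with
  | some pr => pr.b
  | none => 0

/-- `a = a₀, …, aₘ, [aₘ₊₁, …, aₘ₊ₜ]`: from the index `m + 1` on, the sequence repeats with the
(not necessarily least) positive period `T`. -/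
def RepeatsAfter (a : ℕ → ℤ) (m T : ℕ) : Prop :=
  0 < T ∧ ∀ n, m < n → a (n + T) = a n

/-- The block `aₘ₊₁, …, aₘ₊ₜ` is one period of the eventually periodic sequence `a`: it repeats
forever, and `T` is the period length of `a`, that is, the least length of a repeating block. -/
def IsPeriodBlock (a : ℕ → ℤ) (m T : ℕ) : Prop :=
  RepeatsAfter a m T ∧ ∀ m' T', RepeatsAfter a m' T' → T ≤ T'

/-- The number `τ(n)` of positive divisors of a positive integer `n`. -/
def numDivisors (n : ℕ) : ℕ := n.divisors.card

/-- `D(Q) = ∑_{u=1}^{⌊√Q⌋} τ(Q - u²)`. -/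
def divisorSumD (Q : ℕ) : ℕ :=
  ∑ u ∈ Finset.Icc 1 (Nat.sqrt Q), numDivisors (Q - u ^ 2)

/-- The bound `f(Q)`: it is `2 D(Q) + τ(Q)` if `Q` is an integer, and otherwise
`2 ∑ τ(Q - i²/4)` over the odd positive integers `i` with `i² < 4 Q` (every such `i` is less
than `⌈4 Q⌉`). It is meant for positive `Q = Δ/4` with `Δ ≡ 0` or `1` mod `4`. For these `Q` every
number under a floor is an integer, so the floors only change the type. -/
def periodBound (Q : ℚ) : ℕ :=
  if Q.den = 1 then
    2 * divisorSumD ⌊Q⌋₊ + numDivisors ⌊Q⌋₊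
  else
    2 * ∑ i ∈ (Finset.range ⌈4 * Q⌉₊).filter (fun i : ℕ => Odd i ∧ (i : ℚ) ^ 2 < 4 * Q),
      numDivisors ⌊Q - (i : ℚ) ^ 2 / 4⌋₊

/-!
Let `x` be the given quadratic irrational, `z` its conjugate, and `d = p² + 4 r q`. The complete
quotients `yₙ` of `x` and the numbers `zₙ` that arise from `z` by the same substitutions are the two
roots of an integral quadratic polynomial of discriminant `d` (`exists_form_completeQuotient`).
From some index on `zₙ < 0`, since otherwise `z` would have the partial quotients of `x`
(`exists_forall_completeQuotient_neg`); then `yₙ` is the positive root of a polynomial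
`A X² + B X + C` of discriminant `d` with `A > 0 > C`. There are exactly `f(d/4)` such polynomials:
`B` has the parity of `d`, and `A` is a divisor of `(d - B²)/4 = A |C|`. So there are at most
`f(d/4)` such roots (`card_le_periodBound`), and the sequence `yₙ` must repeat, which gives
periodicity.

Within a period, all the numbers `yₙ - k` with `0 ≤ k < aₙ` are such roots as well. There are
`∑ aₙ` of them, all greater than `1`, and they are pairwise different, since a coincidence would
make the period shorter. The reversal `(A, B, C) ↦ (-C, -B, -A)` shows that their inverses, which
are less than `1`, are also such roots. Hence `2 ∑ aₙ ≤ f(d/4)` (`two_mul_sum_le`), whatever the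
parity of the period length; this is the bound claimed for odd `T`, and it implies the other one.
-/

/-! ### Complete quotients -/

/-- The complete quotients of `w` along the partial quotients `a`: `w₀ = w` and
`wₙ₊₁ = 1 / (wₙ - aₙ)`. The sequence `a` need not come from `w` itself: the conjugate of a
quadratic irrational `x` is followed along the partial quotients of `x`. -/
noncomputable def completeQuotient (a : ℕ → ℤ) (w : ℝ) : ℕ → ℝ
  | 0 => w
  | n + 1 => (completeQuotient a w n - a n)⁻¹

theorem completeQuotient_succ (a : ℕ → ℤ) (w : ℝ) (n : ℕ) :
    completeQuotient a w (n + 1) = (completeQuotient a w n - a n)⁻¹ := rfl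

theorem irrational_completeQuotient (a : ℕ → ℤ) {w : ℝ} (hw : Irrational w) (n : ℕ) :
    Irrational (completeQuotient a w n) := by
  induction n with
  | zero => exact hw
  | succ n ih => exact (ih.sub_intCast (a n)).inv

theorem stream_eq_some_completeQuotient {x : ℝ} (hx : Irrational x) (n : ℕ) :
    GenContFract.IntFractPair.stream x n =
      some (GenContFract.IntFractPair.of (completeQuotient (partialQuotient x) x n)) := by
  induction n with
  | zero => rfl
  | succ n ih =>
    have ha : partialQuotient x n = ⌊completeQuotient (partialQuotient x) x n⌋ := by
      unfold partialQuotient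
      rw [ih]
      rfl
    have hirr := irrational_completeQuotient (partialQuotient x) hx n
    have hfr : (GenContFract.IntFractPair.of (completeQuotient (partialQuotient x) x n)).fr
        = completeQuotient (partialQuotient x) x n - partialQuotient x n := by
      rw [ha]
      rfl
    rw [GenContFract.IntFractPair.stream_succ_of_some ih, hfr, completeQuotient_succ]
    rw [hfr]
    exact (hirr.sub_intCast _).ne_zero

theorem partialQuotient_eq_floor {x : ℝ} (hx : Irrational x) (n : ℕ) :
    partialQuotient x n = ⌊completeQuotient (partialQuotient x) x n⌋ := by
  conv_lhs => unfold partialQuotient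
  rw [stream_eq_some_completeQuotient hx n]
  rfl

theorem one_lt_completeQuotient_succ {x : ℝ} (hx : Irrational x) (n : ℕ) :
    1 < completeQuotient (partialQuotient x) x (n + 1) := by
  have hirr := irrational_completeQuotient (partialQuotient x) hx n
  have hne := (hirr.sub_intCast (partialQuotient x n)).ne_zero
  rw [completeQuotient_succ]
  rw [partialQuotient_eq_floor hx n] at hne ⊢
  have h0 := Int.fract_nonneg (completeQuotient (partialQuotient x) x n)
  have h1 := Int.fract_lt_one (completeQuotient (partialQuotient x) x n)
  unfold Int.fract at h0 h1
  exact (one_lt_inv₀ (lt_of_le_of_ne h0 hne.symm)).2 h1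

theorem one_le_partialQuotient_succ {x : ℝ} (hx : Irrational x) (n : ℕ) :
    1 ≤ partialQuotient x (n + 1) := by
  rw [partialQuotient_eq_floor hx, Int.le_floor]
  exact_mod_cast (one_lt_completeQuotient_succ hx n).le

/-- If every complete quotient exceeds `1`, then `aₙ` is the floor of the `n`th one; moreover, two
consecutive complete quotients have product at least `2`. -/
theorem bounds_of_one_lt {a : ℕ → ℤ} {y : ℕ → ℝ} (hy : ∀ n, y (n + 1) = (y n - a n)⁻¹)
    (h1 : ∀ n, 1 < y n) (n : ℕ) :
    (a n : ℝ) < y n ∧ y n < a n + 1 ∧ 2 ≤ y n * y (n + 1) := by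
  have h := h1 (n + 1)
  have hpos : 0 < y n - a n := by
    rw [← inv_pos, ← hy]
    linarith
  have hlt : y n - a n < 1 := by
    rw [hy, one_lt_inv₀ hpos] at h
    exact h
  have ha : (1 : ℝ) ≤ a n := by
    have : (0 : ℝ) < a n := by linarith [h1 n]
    exact_mod_cast this
  refine ⟨by linarith, by linarith, ?_⟩
  have hmul : y (n + 1) * (y n - a n) = 1 := by
    rw [hy]
    exact inv_mul_cancel₀ hpos.ne'
  nlinarith

/-- A number is determined by its partial quotients: two steps of the recursion expand the
distance between two numbers with the same partial quotients at least four times, while that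
distance stays below `1`. -/
theorem eq_of_same_partialQuotients {a : ℕ → ℤ} {y z : ℕ → ℝ}
    (hy : ∀ n, y (n + 1) = (y n - a n)⁻¹) (hz : ∀ n, z (n + 1) = (z n - a n)⁻¹)
    (hy1 : ∀ n, 1 < y n) (hz1 : ∀ n, 1 < z n) : y 0 = z 0 := by
  have step : ∀ n, |y (n + 1) - z (n + 1)| = |y n - z n| * (y (n + 1) * z (n + 1)) := by
    intro n
    have h1 : y n - a n ≠ 0 := by linarith [bounds_of_one_lt hy hy1 n]
    have h2 : z n - a n ≠ 0 := by linarith [bounds_of_one_lt hz hz1 n]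
    have hp : 0 < y (n + 1) * z (n + 1) :=
      mul_pos (by linarith [hy1 (n + 1)]) (by linarith [hz1 (n + 1)])
    rw [← abs_of_pos hp, ← abs_mul, abs_sub_comm (y (n + 1))]
    congr 1
    rw [hy, hz]
    field_simp
    ring
  have grow : ∀ n, 4 ^ n * |y 0 - z 0| ≤ |y (2 * n) - z (2 * n)| := by
    intro n
    induction n with
    | zero => simp
    | succ n ih =>
      have e : 2 * (n + 1) = 2 * n + 1 + 1 := by ring
      rw [e, step, step]
      have h1 := (bounds_of_one_lt hy hy1 (2 * n + 1)).2.2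
      have h2 := (bounds_of_one_lt hz hz1 (2 * n + 1)).2.2
      have h4 : 4 ≤ (y (2 * n + 1) * z (2 * n + 1)) * (y (2 * n + 1 + 1) * z (2 * n + 1 + 1)) := by
        nlinarith
      calc (4 : ℝ) ^ (n + 1) * |y 0 - z 0| = 4 ^ n * |y 0 - z 0| * 4 := by ring
        _ ≤ |y (2 * n) - z (2 * n)| * ((y (2 * n + 1) * z (2 * n + 1)) *
              (y (2 * n + 1 + 1) * z (2 * n + 1 + 1))) := by gcongr
        _ = _ := by ring
  by_contra hne
  have hd : 0 < |y 0 - z 0| := abs_pos.2 (sub_ne_zero.2 hne)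
  obtain ⟨n, hn⟩ := pow_unbounded_of_one_lt (1 / |y 0 - z 0|) (by norm_num : (1 : ℝ) < 4)
  rw [div_lt_iff₀ hd] at hn
  have hlt : |y (2 * n) - z (2 * n)| < 1 := by
    have h1 := bounds_of_one_lt hy hy1 (2 * n)
    have h2 := bounds_of_one_lt hz hz1 (2 * n)
    rw [abs_lt]
    constructor <;> linarith
  linarith [grow n]

theorem completeQuotient_eq_of_tail_eq {x : ℝ} (hx : Irrational x) {i j : ℕ}
    (hi : 0 < i) (hj : 0 < j)
    (h : ∀ n, partialQuotient x (i + n) = partialQuotient x (j + n)) :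
    completeQuotient (partialQuotient x) x i = completeQuotient (partialQuotient x) x j := by
  obtain ⟨i, rfl⟩ := Nat.exists_eq_succ_of_ne_zero hi.ne'
  obtain ⟨j, rfl⟩ := Nat.exists_eq_succ_of_ne_zero hj.ne'
  refine eq_of_same_partialQuotients (a := fun n => partialQuotient x (i.succ + n))
    (y := fun n => completeQuotient (partialQuotient x) x (i.succ + n))
    (z := fun n => completeQuotient (partialQuotient x) x (j.succ + n))
    (fun n => rfl) (fun n => ?_) (fun n => ?_) (fun n => ?_)
  · simp only [h n]
    rfl
  · rw [Nat.succ_add]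
    exact one_lt_completeQuotient_succ hx _
  · rw [Nat.succ_add]
    exact one_lt_completeQuotient_succ hx _

theorem tail_eq_of_completeQuotient_eq {x : ℝ} (hx : Irrational x) {i j : ℕ}
    (h : completeQuotient (partialQuotient x) x i = completeQuotient (partialQuotient x) x j)
    (n : ℕ) : partialQuotient x (i + n) = partialQuotient x (j + n) := by
  have key : ∀ n, completeQuotient (partialQuotient x) x (i + n) =
      completeQuotient (partialQuotient x) x (j + n) := by
    intro n
    induction n with
    | zero => exact h
    | succ n ih =>
      rw [← add_assoc, ← add_assoc, completeQuotient_succ, completeQuotient_succ,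
        partialQuotient_eq_floor hx, partialQuotient_eq_floor hx, ih]
  rw [partialQuotient_eq_floor hx, partialQuotient_eq_floor hx, key]

theorem repeatsAfter_of_completeQuotient_eq {x : ℝ} (hx : Irrational x) {i j m : ℕ}
    (hij : i < j) (him : i ≤ m + 1)
    (h : completeQuotient (partialQuotient x) x i = completeQuotient (partialQuotient x) x j) :
    RepeatsAfter (partialQuotient x) m (j - i) := by
  refine ⟨by omega, fun n hn => ?_⟩
  have e := tail_eq_of_completeQuotient_eq hx h (n - i)
  rw [show i + (n - i) = n by omega, show j + (n - i) = n + (j - i) by omega] at e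
  exact e.symm

/-! ### The conjugate along the continued fraction -/

/-- Following a number `z ≠ x` along the partial quotients of `x` eventually leads to negative
values: otherwise `z` would have the same partial quotients as `x` from the index `1` on. -/
theorem exists_forall_completeQuotient_neg {x z : ℝ} (hx : Irrational x) (hz : Irrational z)
    (hne : z ≠ x) :
    ∃ N, 0 < N ∧ ∀ n, N ≤ n → completeQuotient (partialQuotient x) z n < 0 := by
  have hN : ∃ N, completeQuotient (partialQuotient x) z (N + 1) < 0 := by
    by_contra! hcon
    have hpos : ∀ n, 0 < completeQuotient (partialQuotient x) z (n + 1) := fun n =>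
      lt_of_le_of_ne (hcon n) (irrational_completeQuotient _ hz _).ne_zero.symm
    have h1 : ∀ n, 1 < completeQuotient (partialQuotient x) z (n + 1) := by
      intro n
      have h := hpos (n + 1)
      rw [completeQuotient_succ, inv_pos] at h
      have ha : (1 : ℝ) ≤ partialQuotient x (n + 1) := by
        exact_mod_cast one_le_partialQuotient_succ hx n
      linarith
    have e := eq_of_same_partialQuotients (a := fun n => partialQuotient x (n + 1))
      (y := fun n => completeQuotient (partialQuotient x) z (n + 1))
      (z := fun n => completeQuotient (partialQuotient x) x (n + 1))
      (fun n => rfl) (fun n => rfl) h1 (one_lt_completeQuotient_succ hx)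
    have e' := inv_injective e
    exact hne (by simpa [completeQuotient] using e')
  obtain ⟨N, hN⟩ := hN
  refine ⟨N + 1, by omega, fun n hn => ?_⟩
  induction n, hn using Nat.le_induction with
  | base => exact hN
  | succ n hn ih =>
    obtain ⟨k, rfl⟩ := Nat.exists_eq_add_of_le' (show 1 ≤ n by omega)
    have ha : (1 : ℝ) ≤ partialQuotient x (k + 1) := by
      exact_mod_cast one_le_partialQuotient_succ hx k
    rw [completeQuotient_succ, inv_lt_zero]
    linarith

/-- If `y` and `z` are the two roots of an integral quadratic polynomial of discriminant `d`, then
so are their `n`th complete quotients along any sequence of partial quotients. The roots enter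
through the relations of Vieta. -/
theorem exists_form_completeQuotient {a : ℕ → ℤ} {y z : ℝ} {d : ℤ} (hy : Irrational y)
    (hz : Irrational z)
    (h : ∃ A B C : ℤ, A ≠ 0 ∧ B ^ 2 - 4 * A * C = d ∧ A * (y + z) = -B ∧ A * (y * z) = C) (n : ℕ) :
    ∃ A B C : ℤ, A ≠ 0 ∧ B ^ 2 - 4 * A * C = d ∧
      A * (completeQuotient a y n + completeQuotient a z n) = -B ∧
      A * (completeQuotient a y n * completeQuotient a z n) = C := by
  induction n with
  | zero => exact h
  | succ n ih =>
    obtain ⟨A, B, C, hA, hd, hB, hC⟩ := ih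
    have hyn := ((irrational_completeQuotient a hy n).sub_intCast (a n)).ne_zero
    have hzn := ((irrational_completeQuotient a hz n).sub_intCast (a n)).ne_zero
    rw [completeQuotient_succ, completeQuotient_succ]
    set u := completeQuotient a y n
    set v := completeQuotient a z n
    have hA' : ((A * a n ^ 2 + B * a n + C : ℤ) : ℝ) = A * ((u - a n) * (v - a n)) := by
      push_cast
      linear_combination (a n : ℝ) * hB - hC
    refine ⟨A * a n ^ 2 + B * a n + C, B + 2 * a n * A, A, ?_, ?_, ?_, ?_⟩
    · have : (A : ℝ) * ((u - a n) * (v - a n)) ≠ 0 :=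
        mul_ne_zero (by exact_mod_cast hA) (mul_ne_zero hyn hzn)
      rw [← hA'] at this
      exact_mod_cast this
    · rw [← hd]
      ring
    · rw [hA']
      push_cast
      field_simp
      linear_combination hB
    · rw [hA']
      field_simp

/-! ### Indefinite forms with a positive and a negative root -/

/-- `v` is the positive root of an integral polynomial `A X² + B X + C` of discriminant `d` with
`A > 0 > C`; its other root is then negative. -/
def IsPositiveRoot (d : ℤ) (v : ℝ) : Prop :=
  0 < v ∧ ∃ A B C : ℤ, 0 < A ∧ C < 0 ∧ B ^ 2 - 4 * A * C = d ∧ A * v ^ 2 + B * v + C = 0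

/-- Positivity of `A` costs nothing: the polynomial may be replaced by its negative. -/
theorem isPositiveRoot_of_neg {d : ℤ} {y z : ℝ} (hy : 0 < y) (hz : z < 0)
    (h : ∃ A B C : ℤ, A ≠ 0 ∧ B ^ 2 - 4 * A * C = d ∧ A * (y + z) = -B ∧ A * (y * z) = C) :
    IsPositiveRoot d y := by
  obtain ⟨A, B, C, hA, hd, hB, hC⟩ := h
  have hyz : y * z < 0 := mul_neg_of_pos_of_neg hy hz
  have hroot : (A : ℝ) * y ^ 2 + B * y + C = 0 := by linear_combination -hC + y * hB
  rcases lt_or_gt_of_ne hA with hneg | hpos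
  · refine ⟨hy, -A, -B, -C, by omega, ?_, by linarith, ?_⟩
    · have : (0 : ℝ) < C := by
        rw [← hC]
        exact mul_pos_of_neg_of_neg (by exact_mod_cast hneg) hyz
      have : (0 : ℤ) < C := by exact_mod_cast this
      omega
    · push_cast
      linear_combination -hroot
  · refine ⟨hy, A, B, C, hpos, ?_, hd, hroot⟩
    have : (C : ℝ) < 0 := by
      rw [← hC]
      exact mul_neg_of_pos_of_neg (by exact_mod_cast hpos) hyz
    exact_mod_cast this

/-- Lowering the positive root by `k` lowers the negative one as well. -/
theorem IsPositiveRoot.sub_natCast {d : ℤ} {v : ℝ} (h : IsPositiveRoot d v) {k : ℕ}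
    (hk : (k : ℝ) < v) : IsPositiveRoot d (v - k) := by
  obtain ⟨hv, A, B, C, hA, hC, hd, hroot⟩ := h
  refine ⟨sub_pos.2 hk, A, B + 2 * k * A, A * k ^ 2 + B * k + C, hA, ?_, ?_, ?_⟩
  · have hA' : (0 : ℝ) < A := by exact_mod_cast hA
    have hC' : (C : ℝ) < 0 := by exact_mod_cast hC
    have hk0 : (0 : ℝ) ≤ k := k.cast_nonneg
    -- A convex polynomial that is negative at `0` is negative up to its positive root.
    have : (A : ℝ) * k ^ 2 + B * k + C < 0 := by
      have e : v * ((A : ℝ) * k ^ 2 + B * k + C) = (v - k) * (C - A * v * k) := by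
        linear_combination (k : ℝ) * hroot
      have : (v - k) * (C - A * v * k) < 0 := by
        refine mul_neg_of_pos_of_neg (by linarith) ?_
        have : 0 ≤ A * v * k := by positivity
        linarith
      rw [← e] at this
      exact (pos_iff_neg_of_mul_neg this).1 hv
    exact_mod_cast this
  · rw [← hd]
    ring
  · push_cast
    linear_combination hroot

theorem IsPositiveRoot.inv {d : ℤ} {v : ℝ} (h : IsPositiveRoot d v) : IsPositiveRoot d v⁻¹ := by
  obtain ⟨hv, A, B, C, hA, hC, hd, hroot⟩ := h
  refine ⟨inv_pos.2 hv, -C, -B, -A, by omega, by omega, by linarith, ?_⟩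
  have := hv.ne'
  push_cast
  field_simp
  linear_combination -hroot

/-- The positive root of a polynomial is determined by its coefficients, hence by the pair
`(B, A)` once the discriminant is fixed. -/
theorem positiveRoot_unique {A B C : ℝ} (hA : 0 < A) (hC : C < 0) {v w : ℝ} (hv : 0 < v)
    (hw : 0 < w) (h1 : A * v ^ 2 + B * v + C = 0) (h2 : A * w ^ 2 + B * w + C = 0) : v = w := by
  by_contra hne
  have h : A * (v + w) + B = 0 := by
    have : (v - w) * (A * (v + w) + B) = 0 := by linear_combination h1 - h2
    exact (mul_eq_zero.1 this).resolve_left (sub_ne_zero.2 hne)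
  have : C = A * v * w := by linear_combination h1 - v * h
  have : 0 < A * v * w := by positivity
  linarith

/-! ### Counting the forms -/

theorem sum_Icc_neg_natAbs (h : ℕ → ℕ) (s : ℕ) :
    ∑ b ∈ Finset.Icc (-(s : ℤ)) s, h b.natAbs = h 0 + 2 * ∑ u ∈ Finset.Icc 1 s, h u := by
  induction s with
  | zero => simp
  | succ s ih =>
    have e : Finset.Icc (-((s + 1 : ℕ) : ℤ)) ((s + 1 : ℕ) : ℤ) =
        insert (-((s + 1 : ℕ) : ℤ)) (insert (((s + 1 : ℕ) : ℤ)) (Finset.Icc (-(s : ℤ)) s)) := by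
      ext b
      simp only [Finset.mem_insert, Finset.mem_Icc]
      omega
    rw [e, Finset.sum_insert, Finset.sum_insert, ih, Finset.sum_Icc_succ_top (by omega),
      Int.natAbs_neg, Int.natAbs_natCast]
    · ring
    · simp
    · simp only [Finset.mem_insert, Finset.mem_Icc]
      omega

/-- Positive roots are counted by pairs `(b, A)`, where `B = c b` is the middle coefficient and the
leading coefficient `A` divides `e |b|`, the absolute value of the product `A C`. -/
theorem card_le_sum_divisors {d : ℤ} {V : Finset ℝ} (hV : ∀ v ∈ V, IsPositiveRoot d v)
    (c : ℤ) (s : ℕ) (e : ℕ → ℕ)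
    (h : ∀ A B C : ℤ, 0 < A → C < 0 → B ^ 2 - 4 * A * C = d →
      ∃ b : ℤ, B = c * b ∧ b.natAbs ≤ s ∧ (e b.natAbs : ℤ) = A * -C) :
    V.card ≤ (e 0).divisors.card + 2 * ∑ u ∈ Finset.Icc 1 s, (e u).divisors.card := by
  have hex : ∀ v, ∃ t : (_ : ℤ) × ℕ, v ∈ V →
      t ∈ (Finset.Icc (-(s : ℤ)) s).sigma (fun b => (e b.natAbs).divisors) ∧
      0 < v ∧ ∃ A C : ℤ, 0 < A ∧ C < 0 ∧ (c * t.1) ^ 2 - 4 * A * C = d ∧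
        A * v ^ 2 + ((c * t.1 : ℤ) : ℝ) * v + C = 0 ∧ A = t.2 := by
    intro v
    by_cases hv : v ∈ V
    · obtain ⟨hv0, A, B, C, hA, hC, hd, hroot⟩ := hV v hv
      obtain ⟨b, rfl, hbs, hbe⟩ := h A B C hA hC hd
      refine ⟨⟨b, A.toNat⟩, fun _ => ⟨?_, hv0, A, C, hA, hC, hd, hroot, ?_⟩⟩
      · rw [Finset.mem_sigma, Finset.mem_Icc, Nat.mem_divisors]
        refine ⟨by simp only; omega, ?_, ?_⟩
        · simp only
          rw [← Int.natCast_dvd_natCast, Int.toNat_of_nonneg hA.le, hbe]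
          exact dvd_mul_right _ _
        · simp only
          have : 0 < A * -C := mul_pos hA (by omega)
          omega
      · simp only
        omega
    · exact ⟨⟨0, 0⟩, fun h' => absurd h' hv⟩
  choose f hf using hex
  rw [← sum_Icc_neg_natAbs (fun u => (e u).divisors.card), ← Finset.card_sigma]
  refine Finset.card_le_card_of_injOn f (fun v hv => (hf v hv).1) ?_
  intro v hv w hw hvw
  obtain ⟨-, hv0, A, C, hA, hC, hd, hroot, hAt⟩ := hf v hv
  obtain ⟨-, hw0, A', C', hA', hC', hd', hroot', hAt'⟩ := hf w hw
  rw [← hvw] at hd' hroot' hAt'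
  obtain rfl : A = A' := hAt.trans hAt'.symm
  obtain rfl : C = C' := by
    have : 4 * A * C = 4 * A * C' := by linarith
    exact mul_left_cancel₀ (by omega) this
  exact positiveRoot_unique (by exact_mod_cast hA) (by exact_mod_cast hC) hv0 hw0 hroot hroot'

/-- `f(d/4)` counts the forms `A X² + B X Y + C Y²` of discriminant `d` with `A > 0 > C`. -/
theorem card_le_periodBound {d : ℤ} (hd0 : 0 < d) (hmod : d % 4 = 0 ∨ d % 4 = 1) {V : Finset ℝ}
    (hV : ∀ v ∈ V, IsPositiveRoot d v) : V.card ≤ periodBound ((d : ℚ) / 4) := by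
  lift d to ℕ using hd0.le
  unfold periodBound numDivisors
  rcases hmod with h0 | h1
  · obtain ⟨Q, rfl⟩ : ∃ Q, d = 4 * Q := ⟨d / 4, by omega⟩
    have hQ : (((4 * Q : ℕ) : ℤ) : ℚ) / 4 = (Q : ℚ) := by
      push_cast
      field_simp
    rw [hQ, if_pos (Rat.den_natCast Q), Nat.floor_natCast, add_comm]
    have := card_le_sum_divisors hV 2 (Nat.sqrt Q) (fun u => Q - u ^ 2) (by
      intro A B C hA hC hd
      have hpos : 0 < A * -C := mul_pos hA (by omega)
      obtain ⟨b, rfl⟩ : ∃ b, B = 2 * b := by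
        have h2 : Even (B ^ 2) := ⟨2 * (Q + A * C), by push_cast at hd; linarith⟩
        obtain ⟨b, hb⟩ := (Int.even_pow.1 h2).1
        exact ⟨b, by omega⟩
      have hb : ((b.natAbs ^ 2 : ℕ) : ℤ) + A * -C = Q := by
        push_cast at hd ⊢
        rw [sq_abs]
        linarith
      refine ⟨b, rfl, ?_, ?_⟩
      · rw [Nat.le_sqrt']
        omega
      · omega)
    simpa [divisorSumD, numDivisors] using this
  · have hden : ¬ ((((d : ℕ) : ℤ) : ℚ) / 4).den = 1 := by
      intro h
      have e := (Rat.den_eq_one_iff _).1 h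
      rw [eq_div_iff (by norm_num)] at e
      have : (((d : ℕ) : ℤ) : ℚ) / 4 * 4 = (d : ℤ) := by field_simp
      have e' : ((((d : ℕ) : ℤ) : ℚ) / 4).num * 4 = (d : ℤ) := by exact_mod_cast e
      omega
    rw [if_neg hden]
    have h4 : (4 : ℚ) * (((d : ℤ) : ℚ) / 4) = (d : ℕ) := by
      push_cast
      field_simp
    have hfl : ∀ i : ℕ, i ^ 2 < d → ⌊(((d : ℕ) : ℤ) : ℚ) / 4 - (i : ℚ) ^ 2 / 4⌋₊ =
        (d - i ^ 2) / 4 := by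
      intro i hi
      rw [← Nat.floor_div_eq_div (K := ℚ)]
      push_cast [Nat.cast_sub hi.le]
      congr 1
      ring
    have := card_le_sum_divisors hV 1 d
      (fun u => if Odd u ∧ u ^ 2 < d then (d - u ^ 2) / 4 else 0) (by
      intro A B C hA hC hd
      have hpos : 0 < A * -C := mul_pos hA (by omega)
      have hB : ((B.natAbs ^ 2 : ℕ) : ℤ) + 4 * (A * -C) = d := by
        push_cast
        rw [sq_abs]
        linarith
      have hodd : Odd B.natAbs := by
        have : Odd (B.natAbs ^ 2) := by
          rw [Nat.odd_iff]
          omega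
        exact Nat.Odd.of_mul_left (by rwa [sq] at this)
      have hlt : B.natAbs ^ 2 < d := by omega
      refine ⟨B, by ring, ?_, ?_⟩
      · exact (Nat.le_self_pow two_ne_zero _).trans hlt.le
      · simp only [if_pos (And.intro hodd hlt)]
        omega)
    refine this.trans (le_of_eq ?_)
    rw [h4, Nat.ceil_natCast, Finset.sum_filter]
    simp only [Nat.not_odd_zero, false_and, if_false, Nat.divisors_zero, Finset.card_empty,
      zero_add]
    congr 1
    -- Only odd `u` with `u² < d` contribute, and they lie in both ranges of summation.
    rw [← Finset.sum_filter_add_sum_filter_not (Finset.Icc 1 d) (fun u => Odd u ∧ u ^ 2 < d),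
      ← Finset.sum_filter]
    rw [Finset.sum_eq_zero (s := Finset.filter (fun u => ¬ (Odd u ∧ u ^ 2 < d)) _), add_zero]
    · refine Finset.sum_congr ?_ fun u hu => ?_
      · ext u
        simp only [Finset.mem_filter, Finset.mem_Icc, Finset.mem_range]
        constructor
        · rintro ⟨-, ho, hlt⟩
          exact ⟨(Nat.le_self_pow two_ne_zero u).trans_lt hlt, ho, by exact_mod_cast hlt⟩
        · rintro ⟨hud, ho, hlt⟩
          exact ⟨⟨ho.pos, hud.le⟩, ho, by exact_mod_cast hlt⟩
      · have hu' : Odd u ∧ u ^ 2 < d := by exact_mod_cast (Finset.mem_filter.1 hu).2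
        rw [if_pos hu', hfl u hu'.2]
    · intro u hu
      rw [if_neg (Finset.mem_filter.1 hu).2]
      rfl

/-! ### Periodicity and the length of the period -/

/-- A quadratic irrational has an eventually periodic sequence of partial quotients (Lagrange):
its late complete quotients are positive roots of finitely many forms, so two of them agree. -/
theorem exists_repeatsAfter {x : ℝ} (hx : Irrational x) {d : ℤ} {N F : ℕ}
    (hroot : ∀ n, N ≤ n → IsPositiveRoot d (completeQuotient (partialQuotient x) x n))
    (hF : ∀ V : Finset ℝ, (∀ v ∈ V, IsPositiveRoot d v) → V.card ≤ F) :
    ∃ m T, RepeatsAfter (partialQuotient x) m T := by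
  by_contra! hcon
  have hinj : Set.InjOn (completeQuotient (partialQuotient x) x) (Finset.Icc N (N + F)) := by
    intro i _ j _ hij
    rcases lt_trichotomy i j with h | h | h
    · exact absurd (repeatsAfter_of_completeQuotient_eq hx h (Nat.le_succ i) hij) (hcon _ _)
    · exact h
    · exact absurd (repeatsAfter_of_completeQuotient_eq hx h (Nat.le_succ j) hij.symm) (hcon _ _)
  have hle := hF ((Finset.Icc N (N + F)).image (completeQuotient (partialQuotient x) x)) (by
    intro v hv
    obtain ⟨n, hn, rfl⟩ := Finset.mem_image.1 hv
    exact hroot n (Finset.mem_Icc.1 hn).1)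
  rw [Finset.card_image_of_injOn hinj, Nat.card_Icc] at hle
  omega

theorem exists_isPeriodBlock {a : ℕ → ℤ} (h : ∃ m T, RepeatsAfter a m T) :
    ∃ m T, IsPeriodBlock a m T := by
  classical
  have h' : ∃ T m, RepeatsAfter a m T := by
    obtain ⟨m, T, h⟩ := h
    exact ⟨T, m, h⟩
  obtain ⟨m, hm⟩ := Nat.find_spec h'
  exact ⟨m, Nat.find h', hm, fun m' T' hT => Nat.find_min' h' ⟨m', hT⟩⟩

/-- A complete quotient within the periodic part recurs arbitrarily late, so it inherits what holds
for all late complete quotients. -/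
theorem isPositiveRoot_of_repeatsAfter {x : ℝ} (hx : Irrational x) {d : ℤ} {N m T : ℕ}
    (hroot : ∀ n, N ≤ n → IsPositiveRoot d (completeQuotient (partialQuotient x) x n))
    (h : RepeatsAfter (partialQuotient x) m T) {n : ℕ} (hn : m < n) :
    IsPositiveRoot d (completeQuotient (partialQuotient x) x n) := by
  have hper : ∀ K n, m < n → partialQuotient x (n + K * T) = partialQuotient x n := by
    intro K
    induction K with
    | zero => simp
    | succ K ih =>
      intro n hn
      rw [Nat.succ_mul, ← add_assoc, h.2 _ (by omega), ih n hn]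
  rw [completeQuotient_eq_of_tail_eq hx (i := n) (j := n + N * T) (by omega) (by omega)]
  · exact hroot _ (by nlinarith [h.1])
  · intro k
    rw [add_right_comm, hper N (n + k) (by omega)]

/-- The numbers `yₙ - k` with `0 ≤ k < aₙ` and `n` in a period, together with their inverses, are
pairwise different positive roots. -/
theorem two_mul_sum_le {x : ℝ} (hx : Irrational x) {d : ℤ} {m T F : ℕ}
    (hroot : ∀ n, m < n → IsPositiveRoot d (completeQuotient (partialQuotient x) x n))
    (hF : ∀ V : Finset ℝ, (∀ v ∈ V, IsPositiveRoot d v) → V.card ≤ F)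
    (h : IsPeriodBlock (partialQuotient x) m T) :
    2 * ∑ i ∈ Finset.Icc 1 T, partialQuotient x (m + i) ≤ F := by
  classical
  set y := completeQuotient (partialQuotient x) x with hy
  have hfloor : ∀ n, partialQuotient x n = ⌊y n⌋ := partialQuotient_eq_floor hx
  have hapos : ∀ i, 1 ≤ i → 1 ≤ partialQuotient x (m + i) := by
    intro i hi
    obtain ⟨k, rfl⟩ := Nat.exists_eq_add_of_le' hi
    exact one_le_partialQuotient_succ hx (m + k)
  let I : Finset ((_ : ℕ) × ℕ) :=
    (Finset.Icc 1 T).sigma fun i => Finset.range (partialQuotient x (m + i)).toNat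
  let g : ((_ : ℕ) × ℕ) → ℝ := fun t => y (m + t.1) - t.2
  have hI : (I.card : ℤ) = ∑ i ∈ Finset.Icc 1 T, partialQuotient x (m + i) := by
    rw [Finset.card_sigma]
    push_cast
    refine Finset.sum_congr rfl fun i hi => ?_
    have := hapos i (Finset.mem_Icc.1 hi).1
    rw [Finset.card_range]
    omega
  have hk : ∀ t ∈ I, (t.2 : ℤ) + 1 ≤ ⌊y (m + t.1)⌋ := by
    intro t ht
    have h2 := Finset.mem_range.1 (Finset.mem_sigma.1 ht).2
    rw [← hfloor]
    omega
  have hg1 : ∀ t ∈ I, 1 < g t := by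
    intro t ht
    have h1 : (((t.2 : ℤ) + 1 : ℤ) : ℝ) ≤ y (m + t.1) := Int.le_floor.1 (hk t ht)
    have h2 : y (m + t.1) ≠ (((t.2 : ℤ) + 1 : ℤ) : ℝ) :=
      (irrational_completeQuotient _ hx _).ne_int _
    have h3 := lt_of_le_of_ne h1 h2.symm
    push_cast at h3
    simp only [g]
    linarith
  have hginj : Set.InjOn g I := by
    have key : ∀ t ∈ I, ∀ t' ∈ I, t.1 < t'.1 → g t ≠ g t' := by
      intro t ht t' ht' hlt heq
      -- Equal fractional parts give equal next complete quotients, hence a period below `T`.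
      have hfr : Int.fract (y (m + t.1)) = Int.fract (y (m + t'.1)) := by
        have h1 := congrArg Int.fract heq
        simpa [g, Int.fract_sub_natCast] using h1
      have hnext : y (m + t.1 + 1) = y (m + t'.1 + 1) := by
        rw [hy, completeQuotient_succ, completeQuotient_succ, ← hy, hfloor, hfloor]
        exact congrArg _ hfr
      have hle := h.2 _ _ (repeatsAfter_of_completeQuotient_eq hx (m := m + t.1)
        (by omega) le_rfl hnext)
      have h1 := Finset.mem_Icc.1 (Finset.mem_sigma.1 ht).1
      have h2 := Finset.mem_Icc.1 (Finset.mem_sigma.1 ht').1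
      omega
    intro t ht t' ht' heq
    rcases lt_trichotomy t.1 t'.1 with hlt | he | hlt
    · exact absurd heq (key t ht t' ht' hlt)
    · obtain ⟨i, k⟩ := t
      obtain ⟨i', k'⟩ := t'
      obtain rfl : i = i' := he
      have : (k : ℝ) = k' := by
        simp only [g] at heq
        linarith
      rw [Nat.cast_injective this]
    · exact absurd heq.symm (key t' ht' t ht hlt)
  have hgroot : ∀ t ∈ I, IsPositiveRoot d (g t) := by
    intro t ht
    have h1 := Finset.mem_Icc.1 (Finset.mem_sigma.1 ht).1
    refine (hroot (m + t.1) (by omega)).sub_natCast ?_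
    have := hg1 t ht
    simp only [g] at this
    linarith
  let W := I.image g
  have hW : ∀ v ∈ W, 1 < v ∧ IsPositiveRoot d v := by
    intro v hv
    obtain ⟨t, ht, rfl⟩ := Finset.mem_image.1 hv
    exact ⟨hg1 t ht, hgroot t ht⟩
  have hdisj : Disjoint W (W.image (·⁻¹)) := by
    rw [Finset.disjoint_left]
    intro v hv hv'
    obtain ⟨w, hw, rfl⟩ := Finset.mem_image.1 hv'
    exact lt_asymm (hW _ hv).1 (inv_lt_one_of_one_lt₀ (hW w hw).1)
  have hcard := hF (W ∪ W.image (·⁻¹)) (by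
    intro v hv
    rcases Finset.mem_union.1 hv with hv | hv
    · exact (hW v hv).2
    · obtain ⟨w, hw, rfl⟩ := Finset.mem_image.1 hv
      exact (hW w hw).2.inv)
  rw [Finset.card_union_of_disjoint hdisj, Finset.card_image_of_injective _ inv_injective,
    Finset.card_image_of_injOn hginj] at hcard
  rw [← hI]
  omega

theorem theorem2 (r p q : ℤ) (hr : r ≠ 0) (x : ℝ) (hx : Irrational x)
    (hroot : (r : ℝ) * x ^ 2 + (p : ℝ) * x = (q : ℝ)) :
    (∃ m T : ℕ, IsPeriodBlock (partialQuotient x) m T) ∧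
    ∀ m T : ℕ, IsPeriodBlock (partialQuotient x) m T →
      ((∑ i ∈ Finset.Icc 1 T, partialQuotient x (m + i) : ℤ) : ℚ)
          ≤ (periodBound (((p ^ 2 + 4 * r * q : ℤ) : ℚ) / 4) : ℚ) ∧
      (Odd T →
        ((∑ i ∈ Finset.Icc 1 T, partialQuotient x (m + i) : ℤ) : ℚ)
          ≤ (periodBound (((p ^ 2 + 4 * r * q : ℤ) : ℚ) / 4) : ℚ) / 2) := by
  have hr' : (r : ℝ) ≠ 0 := by exact_mod_cast hr
  obtain ⟨z, hz⟩ : ∃ z, z = ((-p / r : ℚ) : ℝ) - x := ⟨_, rfl⟩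
  have hzirr : Irrational z := hz ▸ hx.ratCast_sub _
  have hsum : (r : ℝ) * (x + z) = -p := by
    rw [hz]
    push_cast
    field_simp
    ring
  have hne : z ≠ x := by
    rintro rfl
    refine hx ⟨-p / (2 * r), ?_⟩
    push_cast
    rw [div_eq_iff (by simpa using hr')]
    linarith
  have hform : ∃ A B C : ℤ, A ≠ 0 ∧ B ^ 2 - 4 * A * C = p ^ 2 + 4 * r * q ∧
      A * (x + z) = -B ∧ A * (x * z) = C := by
    refine ⟨r, p, -q, hr, by ring, hsum, ?_⟩
    push_cast
    linear_combination x * hsum - hroot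
  set d : ℤ := p ^ 2 + 4 * r * q with hd
  have hd0 : 0 < d := by
    have e : (d : ℝ) = (r * (x - z)) ^ 2 := by
      rw [hd]
      push_cast
      linear_combination (p - r * (x + z)) * hsum - 4 * r * hroot + 4 * r * x * hsum
    have : (0 : ℝ) < d := by
      rw [e]
      exact sq_pos_of_ne_zero (mul_ne_zero hr' (sub_ne_zero.2 hne.symm))
    exact_mod_cast this
  have hmod : d % 4 = 0 ∨ d % 4 = 1 := by
    rcases Int.even_or_odd' p with ⟨k, rfl | rfl⟩
    · left
      rw [hd, show (2 * k) ^ 2 + 4 * r * q = 4 * (k ^ 2 + r * q) by ring]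
      omega
    · right
      rw [hd, show (2 * k + 1) ^ 2 + 4 * r * q = 4 * (k ^ 2 + k + r * q) + 1 by ring]
      omega
  obtain ⟨N, hN0, hN⟩ := exists_forall_completeQuotient_neg hx hzirr hne
  have hlate : ∀ n, N ≤ n → IsPositiveRoot d (completeQuotient (partialQuotient x) x n) := by
    intro n hn
    refine isPositiveRoot_of_neg ?_ (hN n hn) (exists_form_completeQuotient hx hzirr hform n)
    obtain ⟨k, rfl⟩ := Nat.exists_eq_add_of_le' (show 1 ≤ n by omega)
    linarith [one_lt_completeQuotient_succ hx k]
  have hF : ∀ V : Finset ℝ, (∀ v ∈ V, IsPositiveRoot d v) → V.card ≤ periodBound ((d : ℚ) / 4) :=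
    fun V hV => card_le_periodBound hd0 hmod hV
  refine ⟨exists_isPeriodBlock (exists_repeatsAfter hx hlate hF), fun m T hT => ?_⟩
  have hmain := two_mul_sum_le hx
    (fun n hn => isPositiveRoot_of_repeatsAfter hx hlate hT.1 hn) hF hT
  have hmainQ : (2 : ℚ) * ((∑ i ∈ Finset.Icc 1 T, partialQuotient x (m + i) : ℤ) : ℚ) ≤
      (periodBound ((d : ℚ) / 4) : ℚ) := by exact_mod_cast hmain
  have hnonneg : (0 : ℚ) ≤ (periodBound ((d : ℚ) / 4) : ℚ) := Nat.cast_nonneg _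
  exact ⟨by linarith, fun _ => by linarith⟩
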